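/- Let $M\le N$ and let a base station with $M$ antennas serve $M$ clusters of $K$ users, each user having $N$ antennas. Let $\mathbf H_{i,j}\in\mathbb C^{N\times M}$ be the channel matrix of the $j$-th user in cluster $i$; all its entries are $\mathcal{CN}(0,1)$, and the entries of the channel matrices of all the users of a cluster are mutually independent (Rayleigh fading). The precoding matrix is $\mathbf P=\mathbf I_M$ with columns $\mathbf p_1,\dots,\mathbf p_M$. Let $\mathbf h$ be the $i$-th column of $\mathbf H_{i,j}$, let $\tilde{\mathbf H}_{i,j}$ be $\mathbf H_{i,j}$ with that column removed, and let $\mathbf U_{i,j}\in\mathbb C^{N\times(N-M+1)}$ have orthonormal columns with $\tilde{\mathbf H}_{i,j}^H\mathbf U_{i,j}=\mathbf 0$ (the left singular vectors of $\tilde{\mathbf H}_{i,j}$ for the singular value $0$). The detection vector is $\mathbf v_{i,j}=\mathbf U_{i,j}\mathbf z_{i,j}$ with the maximal ratio combining weights $\mathbf z_{i,j}=\mathbf U_{i,j}^H\mathbf h/|\mathbf U_{i,j}^H\mathbf h|$. In each cluster the users are ordered by decreasing effective channel gain: after relabelling, $|\mathbf v_{i,1}^H\mathbf H_{i,1}\mathbf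 p_i|^2\ge\dots\ge|\mathbf v_{i,K}^H\mathbf H_{i,K}\mathbf p_i|^2$. In the MIMO-OMA scheme each user is served in one of $K$ time slots, with one user of each cluster in each slot, so that at transmit SNR $\rho>0$ the $k$-th ordered user of cluster $i$ has $$\mathrm{SINR}_{i,k}=\frac{|\mathbf v_{i,k}^H\mathbf H_{i,k}\mathbf p_i|^2}{\sum_{m\ne i}|\mathbf v_{i,k}^H\mathbf H_{i,k}\mathbf p_m|^2+|\mathbf v_{i,k}|^2\frac1\rho}$$ and, for its target rate $R_{i,k}\ge 0$, the outage probability $\mathrm P^o_{i,k}=\mathrm P\left(\tfrac1K\log_2(1+\mathrm{SINR}_{i,k})<R_{i,k}\right)$. Put $\phi_{i,k}=\frac{2^{KR_{i,k}}-1}{\rho}$ and $\gamma(s,x)=\int_0^x t^{s-1}e^{-t}\,dt$. Then for every cluster $i$, every $1\le k\le K$ and every $\rho>0$ $$\mathrm P^o_{i,k}=\sum_{p=0}^{k-1}\binom{k-1}{p}\frac{(-1)^pK!\left[\frac{\gamma(N-M+1,\phi_{i,k})}{(N-M)!}\right]^{K-k+p+1}}{(K-k)!\,(k-1)!\,(K-k+p+1)},$$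 and, as $\rho\to\infty$, $$\mathrm P^o_{i,k}\sim\frac{K!\left[\frac{\phi_{i,k}^{\,N-M+1}}{(N-M+1)!}\right]^{K-k+1}}{(K-k)!\,(k-1)!\,(K-k+1)},$$ that is, the left-hand side is asymptotically equivalent to the right-hand side (their ratio tends to $1$ if $R_{i,k}>0$, and both vanish if $R_{i,k}=0$). -/

import Mathlib

open MeasureTheory ProbabilityTheory Filter Asymptotics
open scoped Matrix Nat NNReal

namespace MimoOma

noncomputable section

/-- The standard circularly symmetric complex Gaussian law `CN(0, 1)`: independent centred real and
imaginary parts, each of variance `1 / 2`. -/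
def complexGaussian : Measure ℂ :=
  ((gaussianReal 0 (1 / 2)).prod (gaussianReal 0 (1 / 2))).map
    (fun q : ℝ × ℝ => (q.1 : ℂ) + (q.2 : ℂ) * Complex.I)

/-- I.i.d. Rayleigh fading. `H i j ω` is the `N × M` channel matrix from the base station to the
`j`-th (not yet ordered) user of cluster `i`. Every entry is `CN(0, 1)`, and the entries of all the
channel matrices of one cluster are mutually independent. (Nothing is required between different
clusters.) -/
structure IsRayleigh {Ω : Type*} [MeasurableSpace Ω] (μ : Measure Ω) {N M K : ℕ}
    (H : Fin M → Fin K → Ω → Matrix (Fin N) (Fin M) ℂ) : Prop where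
  law : ∀ i j a b, HasLaw (fun ω => H i j ω a b) complexGaussian μ
  indep : ∀ i, iIndepFun
    (fun (q : Fin K × Fin N × Fin M) (ω : Ω) => H i q.1 ω q.2.1 q.2.2) μ

/-- The Euclidean norm of a complex vector. -/
def enorm₂ {n : ℕ} (v : Fin n → ℂ) : ℝ :=
  ‖(WithLp.toLp 2 v : EuclideanSpace ℂ (Fin n))‖

/-- The interference matrix: `H` with its `i`-th column removed. -/
def interference {N M : ℕ} (i : Fin M) (H : Matrix (Fin N) (Fin M) ℂ) :
    Matrix (Fin N) {m : Fin M // m ≠ i} ℂ :=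
  H.submatrix id Subtype.val

/-- The `N - M + 1` columns of `U` are orthonormal and are left singular vectors, for the singular
value zero, of the interference matrix. If that matrix has full column rank `M - 1`, which happens
almost surely under Rayleigh fading with `M ≤ N`, they form an orthonormal basis of its whole
left null space. -/
structure IsNullBasis {N M : ℕ} (i : Fin M) (H : Matrix (Fin N) (Fin M) ℂ)
    (U : Matrix (Fin N) (Fin (N - M + 1)) ℂ) : Prop where
  orthonormal : Uᴴ * U = 1
  null : (interference i H)ᴴ * U = 0

/-- The maximal ratio combining weights `z = Uᴴ h / |Uᴴ h|`, `h` being the `i`-th column of `H`. -/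
def mrcWeight {N M : ℕ} (i : Fin M) (H : Matrix (Fin N) (Fin M) ℂ)
    (U : Matrix (Fin N) (Fin (N - M + 1)) ℂ) : Fin (N - M + 1) → ℂ :=
  ((enorm₂ (Uᴴ *ᵥ (fun a => H a i)) : ℂ)⁻¹) • (Uᴴ *ᵥ (fun a => H a i))

/-- The detection vector `v = U z`. -/
def detection {N M : ℕ} (i : Fin M) (H : Matrix (Fin N) (Fin M) ℂ)
    (U : Matrix (Fin N) (Fin (N - M + 1)) ℂ) : Fin N → ℂ :=
  U *ᵥ mrcWeight i H U

/-- The squared modulus `|vᴴ H p|²`. -/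
def gain {N M : ℕ} (v : Fin N → ℂ) (H : Matrix (Fin N) (Fin M) ℂ) (p : Fin M → ℂ) : ℝ :=
  ‖star v ⬝ᵥ (H *ᵥ p)‖ ^ 2

/-- The signal-to-interference-plus-noise ratio of MIMO-OMA at a user of cluster `i` with channel
matrix `H` and detection vector `v`, for the precoding matrix `P` and the transmit SNR `ρ`:
`|vᴴ H pᵢ|² / (∑_{m ≠ i} |vᴴ H pₘ|² + |v|² / ρ)`. -/
def sinr {N M : ℕ} (P : Matrix (Fin M) (Fin M) ℂ) (ρ : ℝ) (i : Fin M)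
    (H : Matrix (Fin N) (Fin M) ℂ) (v : Fin N → ℂ) : ℝ :=
  gain v H (fun a => P a i) /
    (∑ m ∈ Finset.univ.erase i, gain v H (fun a => P a m) + enorm₂ v ^ 2 * (1 / ρ))

/-- The rate of MIMO-OMA in bits per channel use: a user is served in one of `K` time slots. -/
def omaRate (K : ℕ) (s : ℝ) : ℝ :=
  1 / (K : ℝ) * Real.logb 2 (1 + s)

/-- `τ` orders the users of a cluster by decreasing effective channel gain `g`: the `k`-th ordered
user is the user `τ k`. -/
def IsOrdering {K : ℕ} (g : Fin K → ℝ) (τ : Equiv.Perm (Fin K)) : Prop :=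
  ∀ k l : Fin K, k ≤ l → g (τ l) ≤ g (τ k)

/-- The outage probability of the user of cluster `i` at position `k` of the ordering `τ`, for the
target rate `R`, in MIMO-OMA with precoding matrix `P`, null space bases `U` and transmit
SNR `ρ`. -/
def outageProb {Ω : Type*} [MeasurableSpace Ω] (μ : Measure Ω) {N M K : ℕ}
    (H : Fin M → Fin K → Ω → Matrix (Fin N) (Fin M) ℂ)
    (U : Fin M → Fin K → Ω → Matrix (Fin N) (Fin (N - M + 1)) ℂ)
    (P : Matrix (Fin M) (Fin M) ℂ) (τ : Fin M → Ω → Equiv.Perm (Fin K))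
    (i : Fin M) (k : Fin K) (R ρ : ℝ) : ℝ :=
  μ.real {ω | omaRate K (sinr P ρ i (H i (τ i ω k) ω)
    (detection i (H i (τ i ω k) ω) (U i (τ i ω k) ω))) < R}

/-- The lower incomplete gamma function `γ(s, x) = ∫₀ˣ t ^ (s - 1) e⁻ᵗ dt`. -/
def lowerGamma (s x : ℝ) : ℝ :=
  ∫ t in (0 : ℝ)..x, t ^ (s - 1) * Real.exp (-t)

/-- The threshold `φ = (2 ^ (K R) - 1) / ρ`. -/
def threshold (K : ℕ) (R ρ : ℝ) : ℝ :=
  ((2 : ℝ) ^ ((K : ℝ) * R) - 1) / ρ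

end

end MimoOma

/-!
With the identity as precoder, zero forcing turns the SINR of a user into `ρ` times its effective
gain `|Uᴴ h|²` (`sinr_detection`), so outage at position `k` of the ordering means that the gain at
that position lies below the threshold `φ` (`omaRate_lt_iff`).

The gain does not depend on the choice of the null basis `U`. If the interference matrix `A` has
full column rank, then `U Uᴴ = 1 - A (Aᴴ A)⁻¹ Aᴴ` (`mul_conjTranspose_eq_proj`), and full rank holds
almost surely because a Gaussian vector avoids every proper subspace (`ae_linearIndepOn`). Hence the
gain is almost surely `residual A h`, a measurable function of the channel matrix, although no
measurability of `U` or of the ordering is known. Conditionally on `A`, which is independent of `h`,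
the vector `Uᴴ h` is again standard complex Gaussian, by comparison of characteristic functions
(`map_conjTranspose_mulVec`); its density is radial, and integration in polar coordinates shows that
its squared norm has the Gamma distribution function `F = γ(N - M + 1, φ) / (N - M)!`
(`gaussianEuclidean_real_norm_sq_lt`, `residual_measureReal_lt`).

The gains of the users of a cluster are independent, so the outage probability is a binomial tail in
`F` (`IsOrdering.lt_iff`, `measureReal_card_le`), and differentiating in `F` identifies it with the
alternating sum (`sum_choose_eq_sum_alternating`). As `ρ → ∞` the threshold tends to zero, where
`F ~ φ ^ (N - M + 1) / (N - M + 1)!` (`lowerGamma_isEquivalent`) and the term `p = 0` of the sum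
dominates (`alternating_sum_isEquivalent`).
-/

namespace MimoOma

/-! ### Zero-forcing detection and the projection onto the left null space -/

/-- The squared norm `|z|²`, as the Hermitian form `zᴴ z`. -/
lemma star_dotProduct_self {n : ℕ} (z : Fin n → ℂ) :
    star z ⬝ᵥ z = ((enorm₂ z ^ 2 : ℝ) : ℂ) := by
  have h := EuclideanSpace.norm_sq_eq (WithLp.toLp 2 z : EuclideanSpace ℂ (Fin n))
  rw [enorm₂, h]
  simp only [dotProduct, Pi.star_apply, Complex.ofReal_sum]
  refine Finset.sum_congr rfl fun a _ => ?_
  rw [RCLike.star_def, ← Complex.normSq_eq_conj_mul_self, Complex.normSq_eq_norm_sq]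

lemma enorm₂_smul {n : ℕ} (c : ℂ) (z : Fin n → ℂ) : enorm₂ (c • z) = ‖c‖ * enorm₂ z := by
  simp [enorm₂, norm_smul]

/-- A matrix with orthonormal columns preserves the Euclidean norm. -/
lemma enorm₂_mulVec {N n : ℕ} {U : Matrix (Fin N) (Fin n) ℂ} (hU : Uᴴ * U = 1) (z : Fin n → ℂ) :
    enorm₂ (U *ᵥ z) = enorm₂ z := by
  have h : star (U *ᵥ z) ⬝ᵥ (U *ᵥ z) = star z ⬝ᵥ z := by
    rw [Matrix.star_mulVec, Matrix.dotProduct_mulVec, Matrix.vecMul_vecMul, hU, Matrix.vecMul_one]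
  rw [star_dotProduct_self, star_dotProduct_self, Complex.ofReal_inj] at h
  exact (sq_eq_sq₀ (norm_nonneg _) (norm_nonneg _)).1 h

section Detection

variable {N M : ℕ} {i : Fin M} {H : Matrix (Fin N) (Fin M) ℂ}
  {U : Matrix (Fin N) (Fin (N - M + 1)) ℂ}

lemma mulVec_one_col (H : Matrix (Fin N) (Fin M) ℂ) (m : Fin M) :
    H *ᵥ (fun a => (1 : Matrix (Fin M) (Fin M) ℂ) a m) = fun a => H a m := by
  ext a
  simp [Matrix.mulVec, dotProduct, Matrix.one_apply]

lemma star_detection_dotProduct (H : Matrix (Fin N) (Fin M) ℂ)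
    (U : Matrix (Fin N) (Fin (N - M + 1)) ℂ) (w : Fin N → ℂ) :
    star (detection i H U) ⬝ᵥ w = star (mrcWeight i H U) ⬝ᵥ (Uᴴ *ᵥ w) := by
  rw [detection, Matrix.star_mulVec, Matrix.dotProduct_mulVec]

/-- Maximal ratio combining collects the whole energy of the desired signal that survives the
projection. If `Uᴴ h = 0`, the weight is zero and so is the gain. -/
lemma gain_detection_self (H : Matrix (Fin N) (Fin M) ℂ)
    (U : Matrix (Fin N) (Fin (N - M + 1)) ℂ) :
    gain (detection i H U) H (fun a => (1 : Matrix (Fin M) (Fin M) ℂ) a i) =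
      enorm₂ (Uᴴ *ᵥ (fun a => H a i)) ^ 2 := by
  rw [gain, mulVec_one_col, star_detection_dotProduct, mrcWeight, star_smul, smul_dotProduct,
    star_dotProduct_self]
  set e := enorm₂ (Uᴴ *ᵥ (fun a => H a i)) with he
  have he0 : 0 ≤ e := norm_nonneg _
  rcases he0.eq_or_lt with h0 | h0
  · simp [← h0]
  · simp only [smul_eq_mul, norm_mul, norm_star, norm_inv, Complex.norm_real, Real.norm_eq_abs,
      abs_of_pos h0, abs_of_pos (pow_pos h0 2)]
    field_simp

/-- Zero forcing: the streams of the other clusters are cancelled. -/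
lemma gain_detection_of_ne (hU : IsNullBasis i H U) {m : Fin M} (hm : m ≠ i) :
    gain (detection i H U) H (fun a => (1 : Matrix (Fin M) (Fin M) ℂ) a m) = 0 := by
  have h : Uᴴ *ᵥ (fun a => H a m) = 0 := by
    have h1 : Uᴴ * interference i H = 0 := by
      have := congrArg Matrix.conjTranspose hU.null
      simpa using this
    ext b
    exact congrFun (congrFun h1 b) ⟨m, hm⟩
  rw [gain, mulVec_one_col, star_detection_dotProduct, h]
  simp

lemma enorm₂_detection (hU : IsNullBasis i H U) (h : enorm₂ (Uᴴ *ᵥ (fun a => H a i)) ≠ 0) :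
    enorm₂ (detection i H U) = 1 := by
  have h0 : 0 ≤ enorm₂ (Uᴴ *ᵥ (fun a => H a i)) := norm_nonneg _
  rw [detection, enorm₂_mulVec hU.orthonormal, mrcWeight, enorm₂_smul, norm_inv,
    Complex.norm_real, Real.norm_of_nonneg h0, inv_mul_cancel₀ h]

/-- With zero forcing the SINR is the SNR times the effective channel gain. -/
lemma sinr_detection (hU : IsNullBasis i H U) (ρ : ℝ) :
    sinr 1 ρ i H (detection i H U) = ρ * enorm₂ (Uᴴ *ᵥ (fun a => H a i)) ^ 2 := by
  have hsum : ∑ m ∈ Finset.univ.erase i,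
      gain (detection i H U) H (fun a => (1 : Matrix (Fin M) (Fin M) ℂ) a m) = 0 :=
    Finset.sum_eq_zero fun m hm => gain_detection_of_ne hU (Finset.ne_of_mem_erase hm)
  rw [sinr, hsum, gain_detection_self]
  by_cases h : enorm₂ (Uᴴ *ᵥ (fun a => H a i)) = 0
  · simp [h]
  · rw [enorm₂_detection hU h]
    simp [mul_comm]

end Detection

lemma omaRate_lt_iff {K : ℕ} (hK : 0 < K) {R ρ g : ℝ} (hρ : 0 < ρ) (hg : 0 ≤ g) :
    omaRate K (ρ * g) < R ↔ g < threshold K R ρ := by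
  have hK' : (0 : ℝ) < K := Nat.cast_pos.2 hK
  have h1 : 0 < 1 + ρ * g := by positivity
  rw [omaRate, threshold, lt_div_iff₀ hρ, one_div, inv_mul_lt_iff₀ hK',
    Real.logb_lt_iff_lt_rpow one_lt_two h1, lt_sub_iff_add_lt, add_comm, mul_comm g]

section Residual

variable {N : ℕ} {ι : Type*} [Fintype ι] [DecidableEq ι]

/-- The squared distance from `h` to the column space of `A`, as the Hermitian form of the
orthogonal projection `1 - A (Aᴴ A)⁻¹ Aᴴ`. It has this meaning only if `A` has full column rank;
the explicit formula makes it a measurable function of `A` and `h`. -/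
noncomputable def residual (A : Matrix (Fin N) ι ℂ) (h : Fin N → ℂ) : ℝ :=
  (star h ⬝ᵥ ((1 - A * (Aᴴ * A)⁻¹ * Aᴴ) *ᵥ h)).re

/-- If the columns of `A` and of `U` together span the whole space, the columns of `U` being
orthonormal and orthogonal to those of `A`, then `U Uᴴ` is the projection in `residual`. -/
lemma mul_conjTranspose_eq_proj {n : ℕ} (hn : Fintype.card ι + n = N)
    {A : Matrix (Fin N) ι ℂ} {U : Matrix (Fin N) (Fin n) ℂ} (hA : IsUnit (Aᴴ * A).det)
    (hU : Uᴴ * U = 1) (hAU : Aᴴ * U = 0) :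
    U * Uᴴ = 1 - A * (Aᴴ * A)⁻¹ * Aᴴ := by
  have hUA : Uᴴ * A = 0 := by simpa using congrArg Matrix.conjTranspose hAU
  -- `[(Aᴴ A)⁻¹ Aᴴ; Uᴴ]` is a left inverse of the square matrix `[A, U]`, hence a right inverse
  have h1 : Matrix.fromRows ((Aᴴ * A)⁻¹ * Aᴴ) Uᴴ * Matrix.fromCols A U = 1 := by
    rw [Matrix.fromRows_mul_fromCols, Matrix.mul_assoc, Matrix.nonsing_inv_mul _ hA,
      Matrix.mul_assoc, hAU, hUA, hU, Matrix.mul_zero, Matrix.fromBlocks_one]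
  rw [Matrix.mul_eq_one_comm_of_card_eq _ _ _ (by simp [hn]), Matrix.fromCols_mul_fromRows,
    ← Matrix.mul_assoc] at h1
  exact eq_sub_of_add_eq' h1

lemma residual_eq {n : ℕ} (hn : Fintype.card ι + n = N)
    {A : Matrix (Fin N) ι ℂ} {U : Matrix (Fin N) (Fin n) ℂ} (hA : IsUnit (Aᴴ * A).det)
    (hU : Uᴴ * U = 1) (hAU : Aᴴ * U = 0) (h : Fin N → ℂ) :
    residual A h = enorm₂ (Uᴴ *ᵥ h) ^ 2 := by
  rw [residual, ← mul_conjTranspose_eq_proj hn hA hU hAU, ← Matrix.mulVec_mulVec,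
    Matrix.dotProduct_mulVec]
  have : star h ᵥ* U = star (Uᴴ *ᵥ h) := by
    rw [Matrix.star_mulVec, Matrix.conjTranspose_conjTranspose]
  rw [this, star_dotProduct_self, Complex.ofReal_re]

open scoped ComplexOrder in
lemma isUnit_det_conjTranspose_mul_self {A : Matrix (Fin N) ι ℂ}
    (hA : LinearIndependent ℂ A.col) : IsUnit (Aᴴ * A).det := by
  have hinj : Function.Injective A.mulVec := Matrix.mulVec_injective_iff.2 hA
  exact (Matrix.isUnit_iff_isUnit_det _).1
    (Matrix.PosDef.conjTranspose_mul_self A hinj).isUnit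

omit [DecidableEq ι] in
/-- The left null space of a matrix with full column rank has an orthonormal basis of the expected
size. -/
lemma exists_orthonormal_null {n : ℕ} (hn : Fintype.card ι + n = N)
    {A : Matrix (Fin N) ι ℂ} (hA : LinearIndependent ℂ A.col) :
    ∃ U : Matrix (Fin N) (Fin n) ℂ, Uᴴ * U = 1 ∧ Aᴴ * U = 0 := by
  let c : ι → EuclideanSpace ℂ (Fin N) := fun m => WithLp.toLp 2 (A.col m)
  have hc : LinearIndependent ℂ c :=
    hA.map' (WithLp.linearEquiv 2 ℂ (Fin N → ℂ)).symm.toLinearMap (LinearEquiv.ker _)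
  let W := Submodule.span ℂ (Set.range c)
  have hW : Module.finrank ℂ W = Fintype.card ι := finrank_span_eq_card hc
  have hWo : Module.finrank ℂ Wᗮ = n := by
    have := W.finrank_add_finrank_orthogonal
    rw [hW, finrank_euclideanSpace_fin] at this
    omega
  let b := (stdOrthonormalBasis ℂ Wᗮ).reindex (finCongr hWo)
  have hin (x y : EuclideanSpace ℂ (Fin N)) : inner ℂ x y = ∑ a, star (x a) * y a := by
    rw [PiLp.inner_apply]
    exact Finset.sum_congr rfl fun a _ => by simp [mul_comm]
  refine ⟨Matrix.of fun a p => (b p : EuclideanSpace ℂ (Fin N)) a, ?_, ?_⟩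
  · ext p q
    have := orthonormal_iff_ite.1 b.orthonormal p q
    rw [Submodule.coe_inner, hin] at this
    simpa [Matrix.mul_apply, Matrix.one_apply] using this
  · ext m p
    have hm : c m ∈ W := Submodule.subset_span ⟨m, rfl⟩
    have := (Submodule.mem_orthogonal W _).1 (b p).2 _ hm
    rw [hin] at this
    simpa [Matrix.mul_apply, c] using this

lemma measurable_residual :
    Measurable fun q : (ι → Fin N → ℂ) × (Fin N → ℂ) =>
      residual (Matrix.of fun a m => q.1 m a) q.2 := by
  let A : (ι → Fin N → ℂ) × (Fin N → ℂ) → Matrix (Fin N) ι ℂ := fun q => Matrix.of fun a m => q.1 m a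
  have hA : Continuous A := continuous_matrix fun a m => by simp only [A, Matrix.of_apply]; fun_prop
  have hG : Continuous fun q => (A q)ᴴ * A q := hA.matrix_conjTranspose.matrix_mul hA
  have hinv (m l : ι) : Measurable fun q => ((A q)ᴴ * A q)⁻¹ m l := by
    simp only [Matrix.inv_def, Matrix.smul_apply, smul_eq_mul, Ring.inverse_eq_inv]
    exact hG.matrix_det.measurable.inv.mul (hG.matrix_adjugate.matrix_elem m l).measurable
  have hmul (a : Fin N) (l : ι) : Measurable fun q => (A q * ((A q)ᴴ * A q)⁻¹) a l := by
    simp only [Matrix.mul_apply (M := A _)]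
    exact Finset.measurable_fun_sum _ fun m _ => (hA.matrix_elem a m).measurable.mul (hinv m l)
  have hproj (a b : Fin N) :
      Measurable fun q => (1 - A q * ((A q)ᴴ * A q)⁻¹ * (A q)ᴴ : Matrix (Fin N) (Fin N) ℂ) a b := by
    simp only [Matrix.sub_apply, Matrix.mul_apply (N := (A _)ᴴ)]
    exact measurable_const.sub (Finset.measurable_fun_sum _ fun m _ =>
      (hmul a m).mul (hA.matrix_conjTranspose.matrix_elem m b).measurable)
  have hcoord (a : Fin N) : Measurable fun q : (ι → Fin N → ℂ) × (Fin N → ℂ) => q.2 a :=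
    (measurable_pi_apply a).comp measurable_snd
  have hmv (a : Fin N) : Measurable fun q : (ι → Fin N → ℂ) × (Fin N → ℂ) =>
      ((1 - A q * ((A q)ᴴ * A q)⁻¹ * (A q)ᴴ : Matrix (Fin N) (Fin N) ℂ) *ᵥ q.2) a := by
    simp only [Matrix.mulVec, dotProduct]
    exact Finset.measurable_fun_sum _ fun b _ => (hproj a b).mul (hcoord b)
  refine Complex.measurable_re.comp ?_
  simp only [dotProduct, Pi.star_apply]
  exact Finset.measurable_fun_sum _ fun a _ =>
    (continuous_star.measurable.comp (hcoord a)).mul (hmv a)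

end Residual

/-! ### The standard complex Gaussian vector -/

instance : IsProbabilityMeasure complexGaussian :=
  Measure.isProbabilityMeasure_map (by fun_prop)

/-- The law of a vector of `n` independent `CN(0, 1)` entries. -/
noncomputable def gaussianVec (n : ℕ) : Measure (Fin n → ℂ) := Measure.pi fun _ => complexGaussian

instance (n : ℕ) : IsProbabilityMeasure (gaussianVec n) := by
  unfold gaussianVec
  infer_instance

/-- The law of a standard complex Gaussian vector, on the space with the Euclidean norm. -/
noncomputable def gaussianEuclidean (n : ℕ) : Measure (EuclideanSpace ℂ (Fin n)) :=
  (gaussianVec n).map (WithLp.toLp 2)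

instance (n : ℕ) : IsProbabilityMeasure (gaussianEuclidean n) :=
  Measure.isProbabilityMeasure_map (by fun_prop)

lemma charFun_complexGaussian (t : ℂ) :
    charFun complexGaussian t = Complex.exp (-(‖t‖ : ℂ) ^ 2 / 4) := by
  rw [charFun_apply, complexGaussian, integral_map (by fun_prop) (by fun_prop)]
  have h (q : ℝ × ℝ) :
      Complex.exp (inner ℝ ((q.1 : ℂ) + (q.2 : ℂ) * Complex.I) t * Complex.I) =
        Complex.exp (t.re * q.1 * Complex.I) * Complex.exp (t.im * q.2 * Complex.I) := by
    rw [← Complex.exp_add, Complex.inner]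
    congr 1
    simp
    ring
  simp_rw [h]
  rw [integral_prod_mul (fun x : ℝ => Complex.exp (t.re * x * Complex.I))
    (fun x : ℝ => Complex.exp (t.im * x * Complex.I)), ← charFun_apply_real, ← charFun_apply_real,
    charFun_gaussianReal, charFun_gaussianReal, ← Complex.exp_add, ← Complex.ofReal_pow ‖t‖,
    Complex.sq_norm, Complex.normSq_apply]
  congr 1
  push_cast
  simp
  ring

lemma charFun_gaussianEuclidean {n : ℕ} (t : EuclideanSpace ℂ (Fin n)) :
    charFun (gaussianEuclidean n) t = Complex.exp (-(‖t‖ : ℂ) ^ 2 / 4) := by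
  rw [gaussianEuclidean, gaussianVec, charFun_pi]
  simp_rw [charFun_complexGaussian]
  rw [← Complex.exp_sum, ← Complex.ofReal_pow, EuclideanSpace.norm_sq_eq]
  push_cast
  rw [← Finset.sum_neg_distrib, Finset.sum_div]

/-- Orthonormal coordinates of a standard complex Gaussian vector form a standard complex Gaussian
vector. -/
lemma map_conjTranspose_mulVec {N n : ℕ} {U : Matrix (Fin N) (Fin n) ℂ} (hU : Uᴴ * U = 1) :
    (gaussianVec N).map (fun h => WithLp.toLp 2 (Uᴴ *ᵥ h)) = gaussianEuclidean n := by
  have hc : Continuous fun h : Fin N → ℂ => WithLp.toLp 2 (Uᴴ *ᵥ h) :=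
    (PiLp.continuous_toLp 2 _).comp (continuous_const.matrix_mulVec continuous_id)
  have := Measure.isProbabilityMeasure_map (μ := gaussianVec N) hc.aemeasurable
  refine Measure.ext_of_charFun (funext fun t => ?_)
  -- `⟪Uᴴ h, t⟫ = ⟪h, U t⟫`, and `U` preserves the norm of `t`
  have h1 : charFun (gaussianEuclidean N) (WithLp.toLp 2 (U *ᵥ t.ofLp)) =
      charFun ((gaussianVec N).map (fun h => WithLp.toLp 2 (Uᴴ *ᵥ h))) t := by
    rw [charFun_apply, charFun_apply, gaussianEuclidean,
      integral_map (by fun_prop) (by fun_prop), integral_map hc.aemeasurable (by fun_prop)]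
    have hin {m : ℕ} (x y : EuclideanSpace ℂ (Fin m)) :
        inner ℝ x y = (star x.ofLp ⬝ᵥ y.ofLp).re := by
      rw [PiLp.inner_apply, dotProduct, Complex.re_sum]
      exact Finset.sum_congr rfl fun a _ => by rw [Complex.inner, mul_comm]; rfl
    refine integral_congr_ae (Eventually.of_forall fun h => ?_)
    simp only [hin]
    rw [Matrix.star_mulVec, Matrix.conjTranspose_conjTranspose, Matrix.dotProduct_mulVec]
  rw [← h1, charFun_gaussianEuclidean, charFun_gaussianEuclidean]
  have h2 := enorm₂_mulVec hU t.ofLp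
  rw [enorm₂, enorm₂] at h2
  rw [h2]

/-- The standard complex Gaussian vector has density `π⁻ⁿ exp (-‖v‖²)`. -/
lemma gaussianEuclidean_eq_withDensity (n : ℕ) :
    gaussianEuclidean n = volume.withDensity
      (fun v => ENNReal.ofReal ((Real.pi ^ n)⁻¹ * Real.exp (-‖v‖ ^ 2))) := by
  have hdim : Module.finrank ℝ (EuclideanSpace ℂ (Fin n)) = 2 * n := by
    rw [finrank_real_of_complex, finrank_euclideanSpace_fin]
  have hint : Integrable fun v : EuclideanSpace ℂ (Fin n) =>
      (Real.pi ^ n)⁻¹ * Real.exp (-‖v‖ ^ 2) := by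
    refine Integrable.const_mul ?_ _
    have := GaussianFourier.integrable_cexp_neg_mul_sq_norm_add (b := 1) (by simp) 0
      (0 : EuclideanSpace ℂ (Fin n))
    refine this.norm.congr (Eventually.of_forall fun v => ?_)
    simp [Complex.norm_exp, ← Complex.ofReal_pow]
  have := isFiniteMeasure_withDensity_ofReal hint.2
  refine Measure.ext_of_charFun (funext fun t => ?_)
  rw [charFun_gaussianEuclidean, charFun_apply, integral_withDensity_eq_integral_toReal_smul
    (by fun_prop) (by simp)]
  have h1 (v : EuclideanSpace ℂ (Fin n)) :
      (ENNReal.ofReal ((Real.pi ^ n)⁻¹ * Real.exp (-‖v‖ ^ 2))).toReal •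
        Complex.exp (inner ℝ v t * Complex.I) =
      ((Real.pi : ℂ) ^ n)⁻¹ * Complex.exp (-1 * ‖v‖ ^ 2 + Complex.I * inner ℝ t v) := by
    rw [ENNReal.toReal_ofReal (by positivity), Complex.real_smul, Complex.exp_add, real_inner_comm]
    push_cast
    ring_nf
  simp_rw [h1]
  rw [integral_const_mul, GaussianFourier.integral_cexp_neg_mul_sq_norm_add (by simp), hdim]
  have hpi : (Real.pi : ℂ) ^ n ≠ 0 := pow_ne_zero _ (by exact_mod_cast Real.pi_ne_zero)
  have h2 : ((2 * n : ℕ) : ℂ) / 2 = n := by push_cast; ring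
  rw [h2, div_one, Complex.cpow_natCast, ← mul_assoc, inv_mul_cancel₀ hpi, one_mul, Complex.I_sq]
  congr 1
  ring

/-- A proper subspace is null for the standard complex Gaussian vector. -/
lemma gaussianVec_submodule {n : ℕ} {W : Submodule ℂ (Fin n → ℂ)} (hW : W ≠ ⊤) :
    gaussianVec n W = 0 := by
  let e := (WithLp.linearEquiv 2 ℂ (Fin n → ℂ))
  let W' : Submodule ℝ (EuclideanSpace ℂ (Fin n)) := (W.comap e.toLinearMap).restrictScalars ℝ
  have hW' : W' ≠ ⊤ := by
    intro h
    refine hW (eq_top_iff.2 fun x _ => ?_)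
    have : WithLp.toLp 2 x ∈ W' := h ▸ Submodule.mem_top
    exact this
  have h0 : gaussianEuclidean n W' = 0 := by
    rw [gaussianEuclidean_eq_withDensity]
    exact withDensity_absolutelyContinuous _ _ (Measure.addHaar_submodule _ _ hW')
  rw [gaussianEuclidean, Measure.map_apply (by fun_prop)
    W'.closed_of_finiteDimensional.measurableSet] at h0
  exact h0

/-- At an integer argument the real power in the integrand is a natural power. -/
lemma lowerGamma_natCast_succ (n : ℕ) (x : ℝ) :
    lowerGamma ((n + 1 : ℕ) : ℝ) x = ∫ t in (0 : ℝ)..x, t ^ n * Real.exp (-t) := by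
  simp [lowerGamma]

/-- The squared norm of a standard complex Gaussian vector is Gamma distributed. -/
lemma gaussianEuclidean_real_norm_sq_lt (n : ℕ) {x : ℝ} (hx : 0 ≤ x) :
    (gaussianEuclidean (n + 1)).real {v | ‖v‖ ^ 2 < x} =
      lowerGamma ((n + 1 : ℕ) : ℝ) x / (n ! : ℝ) := by
  have hdim : Module.finrank ℝ (EuclideanSpace ℂ (Fin (n + 1))) = 2 * (n + 1) := by
    rw [finrank_real_of_complex, finrank_euclideanSpace_fin]
  have hS : MeasurableSet {v : EuclideanSpace ℂ (Fin (n + 1)) | ‖v‖ ^ 2 < x} :=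
    measurableSet_lt (by fun_prop) (by fun_prop)
  let g : ℝ → ℝ := (Set.Iio x).indicator fun t => t ^ n * Real.exp (-t)
  let f : ℝ → ℝ := fun r =>
    (Real.pi ^ (n + 1))⁻¹ * (Set.Iio x).indicator (fun t => Real.exp (-t)) (r ^ 2)
  have hf : (gaussianEuclidean (n + 1)).real {v | ‖v‖ ^ 2 < x} =
      ∫ v : EuclideanSpace ℂ (Fin (n + 1)), f ‖v‖ := by
    rw [← integral_indicator_one hS, gaussianEuclidean_eq_withDensity,
      integral_withDensity_eq_integral_toReal_smul (by fun_prop) (by simp)]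
    refine integral_congr_ae (Eventually.of_forall fun v => ?_)
    simp only [f, Set.indicator_apply, Set.mem_ofPred_eq, Set.mem_Iio, Pi.one_apply, smul_eq_mul]
    rw [ENNReal.toReal_ofReal (by positivity)]
    split_ifs <;> simp
  have hball : (volume : Measure (EuclideanSpace ℂ (Fin (n + 1)))).real (Metric.ball 0 1) =
      Real.pi ^ (n + 1) / ((n + 1)! : ℝ) := by
    rw [measureReal_def, InnerProductSpace.volume_ball_of_dim_even hdim]
    simp only [ENNReal.ofReal_one, one_pow, one_mul]
    rw [ENNReal.toReal_ofReal (by positivity)]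
  -- the substitution `t = y ^ 2`
  have hsub : ∫ y in Set.Ioi (0 : ℝ), y ^ (2 * (n + 1) - 1) • f y =
      (Real.pi ^ (n + 1))⁻¹ * (1 / 2) * ∫ t in Set.Ioi (0 : ℝ), g t := by
    rw [← integral_comp_rpow_Ioi_of_pos (g := g) (p := 2) two_pos, ← integral_const_mul]
    refine setIntegral_congr_fun measurableSet_Ioi fun y _ => ?_
    have h1 : ((2 : ℝ) - 1) = 1 := by norm_num
    have h2 : 2 * (n + 1) - 1 = 2 * n + 1 := by omega
    simp only [f, g, smul_eq_mul, Real.rpow_two, h1, h2, Real.rpow_one, Set.indicator_apply]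
    split_ifs
    · ring
    · simp
  have hg : ∫ t in Set.Ioi (0 : ℝ), g t = lowerGamma ((n + 1 : ℕ) : ℝ) x := by
    rw [lowerGamma_natCast_succ, intervalIntegral.integral_of_le hx, integral_Ioc_eq_integral_Ioo,
      setIntegral_indicator measurableSet_Iio]
    rfl
  rw [hf, integral_fun_norm_addHaar, hball, hdim, hsub, hg, Nat.factorial_succ]
  have : (n ! : ℝ) ≠ 0 := by positivity
  push_cast
  simp only [nsmul_eq_mul, smul_eq_mul]
  push_cast
  field_simp

/-- The energy of a standard complex Gaussian vector in the span of `n + 1` orthonormal vectors is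
Gamma distributed with shape `n + 1`. -/
lemma gaussianVec_real_enorm₂_sq_lt {N n : ℕ} {U : Matrix (Fin N) (Fin (n + 1)) ℂ}
    (hU : Uᴴ * U = 1) {x : ℝ} (hx : 0 ≤ x) :
    (gaussianVec N).real {h | enorm₂ (Uᴴ *ᵥ h) ^ 2 < x} =
      lowerGamma ((n + 1 : ℕ) : ℝ) x / (n ! : ℝ) := by
  have hc : Continuous fun h : Fin N → ℂ => WithLp.toLp 2 (Uᴴ *ᵥ h) :=
    (PiLp.continuous_toLp 2 _).comp (continuous_const.matrix_mulVec continuous_id)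
  rw [← gaussianEuclidean_real_norm_sq_lt n hx, ← map_conjTranspose_mulVec hU,
    map_measureReal_apply hc.measurable (measurableSet_lt (by fun_prop) (by fun_prop))]
  rfl

/-! ### Rayleigh fading: independence, full rank and the law of the residual -/

/-- Grouping: independent variables indexed by pairs give independent rows. -/
lemma iIndepFun_rows {Ω : Type*} [MeasurableSpace Ω] {μ : Measure Ω} [IsProbabilityMeasure μ]
    {ι κ E : Type*} [Countable ι] [Countable κ] [MeasurableSpace E] {X : ι → κ → Ω → E}
    (hX : ∀ i k, AEMeasurable (X i k) μ) (h : iIndepFun (fun (q : ι × κ) ω => X q.1 q.2 ω) μ) :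
    iIndepFun (fun i ω k => X i k ω) μ := by
  have hrow (i : ι) : AEMeasurable (fun ω k => X i k ω) μ := aemeasurable_pi_lambda _ (hX i)
  have (i : ι) (k : κ) : IsProbabilityMeasure (μ.map (X i k)) :=
    Measure.isProbabilityMeasure_map (hX i k)
  have hsig : iIndepFun (fun (q : (_ : ι) × κ) ω => X q.1 q.2 ω) μ :=
    h.precomp (Equiv.sigmaEquivProd ι κ).injective
  have hmap := hsig.map_fun_eq_infinitePi_map₀' fun q : (_ : ι) × κ => hX q.1 q.2
  rw [iIndepFun_iff_map_fun_eq_infinitePi_map₀' hrow]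
  have hcurry := Measure.infinitePi_map_piCurry fun i k => μ.map (X i k)
  rw [← hmap, AEMeasurable.map_map_of_aemeasurable (by fun_prop)
    (aemeasurable_pi_lambda _ fun q : (_ : ι) × κ => hX q.1 q.2)] at hcurry
  refine Eq.trans hcurry (congrArg _ (funext fun i => ?_))
  have hi : iIndepFun (X i) μ := h.precomp (g := fun k => (i, k)) fun _ _ hk => (Prod.mk.inj hk).2
  exact (hi.map_fun_eq_infinitePi_map₀' (hX i)).symm

section Columns

variable {Ω : Type*} [MeasurableSpace Ω] {μ : Measure Ω} [IsProbabilityMeasure μ] {N : ℕ}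
  {ι : Type*} [DecidableEq ι] {c : ι → Ω → Fin N → ℂ}

omit [IsProbabilityMeasure μ] [DecidableEq ι] in
/-- The tuple of the vectors with index in `s` is independent of any further vector. -/
lemma indepFun_tuple (hc : iIndepFun c μ) (hm : ∀ b, AEMeasurable (c b) μ) {s : Finset ι} {b : ι}
    (hb : b ∉ s) : IndepFun (fun ω (m : s) => c m ω) (c b) μ := by
  have h := hc.indepFun_finset₀ s {b} (Finset.disjoint_singleton_right.2 hb) hm
  exact h.comp measurable_id
    (measurable_pi_apply (⟨b, Finset.mem_singleton_self b⟩ : ({b} : Finset ι)))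

/-- At most `N` independent standard complex Gaussian vectors in `ℂ ^ N` are almost surely linearly
independent: a further vector almost surely avoids the proper subspace spanned by the others. -/
lemma ae_linearIndepOn (hc : iIndepFun c μ) (hlaw : ∀ b, HasLaw (c b) (gaussianVec N) μ)
    (s : Finset ι) (hs : s.card ≤ N) :
    ∀ᵐ ω ∂μ, LinearIndepOn ℂ (fun b => c b ω) (s : Set ι) := by
  induction s using Finset.induction_on with
  | empty => simp
  | insert b s hb ih =>
    rw [Finset.card_insert_of_notMem hb] at hs
    have hm (b : ι) : AEMeasurable (c b) μ := (hlaw b).aemeasurable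
    have hmt : AEMeasurable (fun ω (m : s) => c m ω) μ := aemeasurable_pi_lambda _ fun m => hm m
    let S : Set ((s → Fin N → ℂ) × (Fin N → ℂ)) :=
      {q | LinearIndependent ℂ q.1 ∧ q.2 ∈ Submodule.span ℂ (Set.range q.1)}
    have hS : MeasurableSet S := by
      have h1 : MeasurableSet {q : (s → Fin N → ℂ) × (Fin N → ℂ) | LinearIndependent ℂ q.1} :=
        (isOpen_setOfPred_linearIndependent.preimage continuous_fst).measurableSet
      -- the complement: appending the new vector keeps the family independent, an open condition
      have hcont : Continuous fun q : (s → Fin N → ℂ) × (Fin N → ℂ) =>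
          (fun o : Option s => Option.casesOn' o q.2 q.1) := by
        refine continuous_pi fun o => ?_
        cases o with
        | none => exact continuous_snd
        | some m => exact (continuous_apply m).comp continuous_fst
      have h2 : MeasurableSet {q : (s → Fin N → ℂ) × (Fin N → ℂ) |
          LinearIndependent ℂ fun o : Option s => (Option.casesOn' o q.2 q.1 : Fin N → ℂ)} :=
        (isOpen_setOfPred_linearIndependent.preimage hcont).measurableSet
      convert h1.diff h2 using 1
      ext q
      simp only [S, Set.mem_ofPred_eq, Set.mem_sdiff, linearIndependent_option']
      tauto
    -- given the vectors in `s`, the new one falls into their span with probability zero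
    have hprod := (indepFun_iff_map_prod_eq_prod_map_map hmt (hm b)).1 (indepFun_tuple hc hm hb)
    have hnull : μ.map (fun ω => ((fun m : s => c m ω), c b ω)) S = 0 := by
      rw [hprod, (hlaw b).map_eq, Measure.measure_prod_null hS]
      refine Eventually.of_forall fun A => ?_
      by_cases hA : LinearIndependent ℂ A
      · have hne : Submodule.span ℂ (Set.range A) ≠ ⊤ := by
          intro htop
          have h1 := finrank_span_eq_card hA
          rw [htop, finrank_top, Module.finrank_fin_fun, Fintype.card_coe] at h1
          omega
        refine measure_mono_null (fun h hh => ?_) (gaussianVec_submodule hne)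
        exact hh.2
      · have : Prod.mk A ⁻¹' S = ∅ := Set.eq_empty_of_forall_notMem fun h hh => hA hh.1
        simp [this]
    rw [Measure.map_apply_of_aemeasurable (hmt.prodMk (hm b)) hS] at hnull
    filter_upwards [ih (by omega), measure_eq_zero_iff_ae_notMem.1 hnull] with ω h1 h2
    rw [Finset.coe_insert]
    refine h1.insert fun h3 => h2 ⟨h1, ?_⟩
    rwa [Set.image_eq_range] at h3

/-- The squared distance of a standard complex Gaussian vector from the span of independent others
is Gamma distributed: condition on the others, which almost surely are linearly independent. -/
lemma residual_measureReal_lt (hc : iIndepFun c μ) (hlaw : ∀ b, HasLaw (c b) (gaussianVec N) μ)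
    {s : Finset ι} {b : ι} (hb : b ∉ s) {n : ℕ} (hn : s.card + (n + 1) = N) {x : ℝ} (hx : 0 ≤ x) :
    μ.real {ω | residual (Matrix.of fun a (m : s) => c m ω a) (c b ω) < x} =
      lowerGamma ((n + 1 : ℕ) : ℝ) x / (n ! : ℝ) := by
  have hm (b : ι) : AEMeasurable (c b) μ := (hlaw b).aemeasurable
  have hmt : AEMeasurable (fun ω (m : s) => c m ω) μ := aemeasurable_pi_lambda _ fun m => hm m
  have hprod := (indepFun_iff_map_prod_eq_prod_map_map hmt (hm b)).1 (indepFun_tuple hc hm hb)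
  let S : Set ((s → Fin N → ℂ) × (Fin N → ℂ)) :=
    {q | residual (Matrix.of fun a m => q.1 m a) q.2 < x}
  have hS : MeasurableSet S := measurableSet_lt measurable_residual measurable_const
  have := Measure.isProbabilityMeasure_map hmt
  have hLI : ∀ᵐ A ∂μ.map (fun ω (m : s) => c m ω), LinearIndependent ℂ A := by
    rw [ae_map_iff hmt isOpen_setOfPred_linearIndependent.measurableSet]
    exact ae_linearIndepOn hc hlaw s (by omega)
  have hsec : ∀ᵐ A ∂μ.map (fun ω (m : s) => c m ω), gaussianVec N (Prod.mk A ⁻¹' S) =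
      ENNReal.ofReal (lowerGamma ((n + 1 : ℕ) : ℝ) x / (n ! : ℝ)) := by
    filter_upwards [hLI] with A hA
    have hcol : LinearIndependent ℂ (Matrix.of fun a m => A m a : Matrix (Fin N) s ℂ).col := hA
    have hcard : Fintype.card s + (n + 1) = N := by rw [Fintype.card_coe, hn]
    obtain ⟨U, hU, hAU⟩ := exists_orthonormal_null hcard hcol
    have hunit := isUnit_det_conjTranspose_mul_self hcol
    rw [← gaussianVec_real_enorm₂_sq_lt hU hx, ofReal_measureReal]
    congr 1
    ext h
    exact iff_of_eq (congrArg (· < x) (residual_eq hcard hunit hU hAU h))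
  have hval : μ.map (fun ω => ((fun m : s => c m ω), c b ω)) S =
      ENNReal.ofReal (lowerGamma ((n + 1 : ℕ) : ℝ) x / (n ! : ℝ)) := by
    rw [hprod, (hlaw b).map_eq, Measure.prod_apply hS, lintegral_congr_ae hsec, lintegral_const,
      measure_univ, mul_one]
  rw [Measure.map_apply_of_aemeasurable (hmt.prodMk (hm b)) hS] at hval
  have hnonneg : 0 ≤ lowerGamma ((n + 1 : ℕ) : ℝ) x / (n ! : ℝ) := by
    rw [← gaussianEuclidean_real_norm_sq_lt n hx]
    exact measureReal_nonneg
  rw [← ENNReal.toReal_ofReal hnonneg, ← hval]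
  rfl

end Columns

/-! ### Order statistics of independent, identically distributed gains -/

/-- With positions counted from zero, the value at position `k` of the decreasing ordering lies
below `x` iff at most `k` values reach `x`. -/
lemma IsOrdering.lt_iff {K : ℕ} {g : Fin K → ℝ} {τ : Equiv.Perm (Fin K)} (hτ : IsOrdering g τ)
    (k : Fin K) (x : ℝ) :
    g (τ k) < x ↔ (Finset.univ.filter fun j => x ≤ g j).card ≤ k := by
  constructor
  · intro h
    have hsub : (Finset.univ.filter fun j => x ≤ g j) ⊆ (Finset.Iio k).map τ.toEmbedding := by
      intro j hj
      rw [Finset.mem_filter] at hj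
      refine Finset.mem_map.2 ⟨τ.symm j, Finset.mem_Iio.2 ?_, by simp⟩
      by_contra! hle
      have := hτ _ _ hle
      rw [Equiv.apply_symm_apply] at this
      linarith [hj.2]
    simpa using Finset.card_le_card hsub
  · intro h
    by_contra! hx
    have hsub : (Finset.Iic k).map τ.toEmbedding ⊆ Finset.univ.filter fun j => x ≤ g j := by
      intro j hj
      obtain ⟨l, hl, rfl⟩ := Finset.mem_map.1 hj
      exact Finset.mem_filter.2 ⟨Finset.mem_univ _, hx.trans (hτ _ _ (Finset.mem_Iic.1 hl))⟩
    have := Finset.card_le_card hsub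
    simp at this
    omega

/-- The number of independent events, each of probability `1 - F`, that occur has a binomial
law. -/
lemma measureReal_card_le {Ω : Type*} [MeasurableSpace Ω] {μ : Measure Ω} [IsProbabilityMeasure μ]
    {K : ℕ} {X : Fin K → Ω → ℝ} (hind : iIndepFun X μ) (hX : ∀ j, AEMeasurable (X j) μ) {x F : ℝ}
    (hF : ∀ j, μ.real {ω | X j ω < x} = F) (k : ℕ) :
    μ.real {ω | (Finset.univ.filter fun j => x ≤ X j ω).card ≤ k} =
      ∑ m ∈ Finset.range (k + 1), (K.choose m : ℝ) * ((1 - F) ^ m * F ^ (K - m)) := by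
  classical
  let B : Finset (Fin K) → Fin K → Set ℝ := fun S j => if j ∈ S then Set.Ici x else Set.Iio x
  have hB (S j) : MeasurableSet (B S j) := by
    by_cases h : j ∈ S
    · simp only [B, h, if_true]; exact measurableSet_Ici
    · simp only [B, h, if_false]; exact measurableSet_Iio
  have hnull (j) {s : Set ℝ} (hs : MeasurableSet s) : NullMeasurableSet (X j ⁻¹' s) μ :=
    (hX j).nullMeasurableSet_preimage hs
  -- the event that exactly the variables with index in `S` reach `x`
  let E : Finset (Fin K) → Set Ω := fun S => ⋂ j ∈ Finset.univ, X j ⁻¹' B S j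
  have hmem (S : Finset (Fin K)) (ω : Ω) :
      ω ∈ E S ↔ (Finset.univ.filter fun j => x ≤ X j ω) = S := by
    simp only [E, B, Set.mem_iInter, Finset.mem_univ, true_implies, Set.mem_preimage,
      Finset.ext_iff, Finset.mem_filter, true_and]
    refine forall_congr' fun j => ?_
    by_cases h : j ∈ S <;> simp [h]
  have hE (S : Finset (Fin K)) : μ.real (E S) = (1 - F) ^ S.card * F ^ (K - S.card) := by
    have h1 := hind.measure_inter_preimage_eq_mul Finset.univ (sets := B S) fun j _ => hB S j
    rw [measureReal_def, h1, ENNReal.toReal_prod]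
    have h2 (j : Fin K) : (μ (X j ⁻¹' B S j)).toReal = if j ∈ S then 1 - F else F := by
      by_cases h : j ∈ S
      · have hc : X j ⁻¹' Set.Ici x = (X j ⁻¹' Set.Iio x)ᶜ := by ext; simp
        simp only [B, h, if_true]
        rw [hc, ← measureReal_def, probReal_compl_eq_one_sub₀ (hnull j measurableSet_Iio)]
        exact congrArg _ (hF j)
      · simp only [B, h, if_false]
        exact hF j
    simp_rw [h2]
    rw [Finset.prod_ite, Finset.prod_const, Finset.prod_const]
    congr 2
    · simp
    · rw [Finset.filter_not, Finset.card_sdiff]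
      simp
  have hunion : {ω | (Finset.univ.filter fun j => x ≤ X j ω).card ≤ k} =
      ⋃ S ∈ (Finset.univ.filter fun S : Finset (Fin K) => S.card ≤ k), E S := by
    ext ω
    simp [hmem]
  rw [hunion, measureReal_biUnion_finset₀]
  · simp_rw [hE]
    have hmaps : ∀ S ∈ Finset.univ.filter fun S : Finset (Fin K) => S.card ≤ k,
        S.card ∈ Finset.range (k + 1) := fun S hS => by
      simpa [Nat.lt_succ_iff] using hS
    rw [← Finset.sum_fiberwise_of_maps_to hmaps]
    refine Finset.sum_congr rfl fun m hm => ?_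
    have hset : ((Finset.univ.filter fun S : Finset (Fin K) => S.card ≤ k).filter
        fun S => S.card = m) = Finset.powersetCard m Finset.univ := by
      ext S
      have := Finset.mem_range.1 hm
      simp [Finset.mem_powersetCard]
      omega
    rw [hset, Finset.sum_congr rfl fun S hS => by rw [(Finset.mem_powersetCard.1 hS).2],
      Finset.sum_const, Finset.card_powersetCard, Finset.card_fin, nsmul_eq_mul]
  · intro S _ T _ hST
    refine (Set.disjoint_left.2 fun ω hS hT => hST ?_).aedisjoint
    rw [← (hmem S ω).1 hS, (hmem T ω).1 hT]
  · exact fun S _ => NullMeasurableSet.biInter (Set.to_countable _) fun j _ => hnull j (hB S j)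

/-- The distribution function of an order statistic, as the incomplete beta integral expanded by
the binomial theorem. Both sides vanish at `F = 0` and have the derivative
`K! / (l! k!) F ^ l (1 - F) ^ k`, where `K = k + l + 1`. -/
lemma sum_choose_eq_sum_alternating (k l : ℕ) (F : ℝ) :
    ∑ m ∈ Finset.range (k + 1),
        ((k + l + 1).choose m : ℝ) * ((1 - F) ^ m * F ^ (k + l + 1 - m)) =
      ∑ p ∈ Finset.range (k + 1), (k.choose p : ℝ) *
        ((-1) ^ p * ((k + l + 1)! : ℝ) * F ^ (l + p + 1) /
          ((l ! : ℝ) * (k ! : ℝ) * ((l + p + 1 : ℕ) : ℝ))) := by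
  -- differentiating the binomial tail, the sum telescopes by induction on the number of terms
  have hL (k l : ℕ) (F : ℝ) : HasDerivAt (fun F : ℝ => ∑ m ∈ Finset.range (k + 1),
      ((k + l + 1).choose m : ℝ) * ((1 - F) ^ m * F ^ (k + l + 1 - m)))
      (((k + l + 1)! : ℝ) / ((l ! : ℝ) * (k ! : ℝ)) * (F ^ l * (1 - F) ^ k)) F := by
    induction k generalizing l with
    | zero =>
      have := hasDerivAt_pow (l + 1) F
      simp only [zero_add, Finset.sum_range_one, Nat.choose_zero_right, Nat.cast_one, pow_zero,
        one_mul, Nat.sub_zero, Nat.factorial_zero, mul_one]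
      refine this.congr_deriv ?_
      rw [Nat.factorial_succ]
      have : (l ! : ℝ) ≠ 0 := by positivity
      push_cast
      field_simp
    | succ k ih =>
      have hK : k + 1 + l + 1 = k + (l + 1) + 1 := by ring
      simp_rw [hK, Finset.sum_range_succ _ (k + 1)]
      have hsub : k + (l + 1) + 1 - (k + 1) = l + 1 := by omega
      rw [hsub]
      have h1 : HasDerivAt (fun F : ℝ => (1 - F) ^ (k + 1)) (-((k + 1 : ℕ) : ℝ) * (1 - F) ^ k) F := by
        refine (((hasDerivAt_id' F).const_sub 1).fun_pow (k + 1)).congr_deriv ?_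
        rw [Nat.add_sub_cancel]
        ring
      have h2 := (h1.mul (hasDerivAt_pow (l + 1) F)).const_mul
        ((k + (l + 1) + 1).choose (k + 1) : ℝ)
      refine ((ih (l + 1)).add h2).congr_deriv ?_
      have hc : ((k + (l + 1) + 1).choose (k + 1) : ℝ) =
          ((k + (l + 1) + 1)! : ℝ) / (((k + 1)! : ℝ) * ((l + 1)! : ℝ)) := by
        rw [Nat.cast_choose ℝ (by omega), hsub]
      rw [hc, Nat.factorial_succ k, Nat.factorial_succ l]
      have : (l ! : ℝ) ≠ 0 := by positivity
      have : (k ! : ℝ) ≠ 0 := by positivity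
      rw [Nat.add_sub_cancel]
      push_cast
      field_simp
      ring
  have hR (F : ℝ) : HasDerivAt (fun F : ℝ => ∑ p ∈ Finset.range (k + 1), (k.choose p : ℝ) *
        ((-1) ^ p * ((k + l + 1)! : ℝ) * F ^ (l + p + 1) /
          ((l ! : ℝ) * (k ! : ℝ) * ((l + p + 1 : ℕ) : ℝ))))
      (((k + l + 1)! : ℝ) / ((l ! : ℝ) * (k ! : ℝ)) * (F ^ l * (1 - F) ^ k)) F := by
    refine (HasDerivAt.fun_sum fun p _ =>
      (((hasDerivAt_pow (l + p + 1) F).const_mul ((-1) ^ p * ((k + l + 1)! : ℝ))).div_const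
        ((l ! : ℝ) * (k ! : ℝ) * ((l + p + 1 : ℕ) : ℝ))).const_mul
          (k.choose p : ℝ)).congr_deriv ?_
    rw [sub_eq_neg_add, add_pow, Finset.mul_sum, Finset.mul_sum]
    refine Finset.sum_congr rfl fun p _ => ?_
    have : ((l + p + 1 : ℕ) : ℝ) ≠ 0 := by positivity
    rw [Nat.add_sub_cancel, neg_pow F, pow_add]
    field_simp
    simp
  have hconst := is_const_of_deriv_eq_zero
    (f := fun F : ℝ => (∑ m ∈ Finset.range (k + 1),
        ((k + l + 1).choose m : ℝ) * ((1 - F) ^ m * F ^ (k + l + 1 - m))) -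
      ∑ p ∈ Finset.range (k + 1), (k.choose p : ℝ) *
        ((-1) ^ p * ((k + l + 1)! : ℝ) * F ^ (l + p + 1) /
          ((l ! : ℝ) * (k ! : ℝ) * ((l + p + 1 : ℕ) : ℝ))))
    (fun F => ((hL k l F).sub (hR F)).differentiableAt)
    (fun F => ((hL k l F).sub (hR F)).deriv.trans (sub_self _)) F 0
  have h0 : (∑ m ∈ Finset.range (k + 1),
      ((k + l + 1).choose m : ℝ) * ((1 - (0 : ℝ)) ^ m * 0 ^ (k + l + 1 - m))) = 0 :=
    Finset.sum_eq_zero fun m hm => by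
      have := Finset.mem_range.1 hm
      rw [zero_pow (by omega)]
      ring
  simp only [h0] at hconst
  simpa [sub_eq_zero] using hconst

/-! ### High-SNR asymptotics -/

/-- Near zero the factor `exp (-t)` in the incomplete gamma integral is close to `1`. -/
lemma lowerGamma_isEquivalent (n : ℕ) :
    (fun x => lowerGamma ((n + 1 : ℕ) : ℝ) x / (n ! : ℝ)) ~[nhdsWithin 0 (Set.Ioi 0)]
      fun x => x ^ (n + 1) / ((n + 1)! : ℝ) := by
  have hint (x : ℝ) : ∫ t in (0 : ℝ)..x, t ^ n = x ^ (n + 1) / (n + 1) := by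
    rw [integral_pow]; simp
  have hn : (n ! : ℝ) ≠ 0 := by positivity
  have hupper : ∀ x : ℝ, 0 < x → lowerGamma ((n + 1 : ℕ) : ℝ) x ≤ x ^ (n + 1) / (n + 1) := by
    intro x hx
    rw [lowerGamma_natCast_succ, ← hint]
    refine intervalIntegral.integral_mono_on hx.le
      (Continuous.intervalIntegrable (by fun_prop) _ _)
      (Continuous.intervalIntegrable (by fun_prop) _ _) fun t ht => ?_
    exact mul_le_of_le_one_right (pow_nonneg ht.1 _) (Real.exp_le_one_iff.2 (by linarith [ht.1]))
  have hlower : ∀ x : ℝ, 0 < x →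
      Real.exp (-x) * (x ^ (n + 1) / (n + 1)) ≤ lowerGamma ((n + 1 : ℕ) : ℝ) x := by
    intro x hx
    rw [lowerGamma_natCast_succ, ← hint, ← intervalIntegral.integral_const_mul]
    refine intervalIntegral.integral_mono_on hx.le
      (Continuous.intervalIntegrable (by fun_prop) _ _)
      (Continuous.intervalIntegrable (by fun_prop) _ _) fun t ht => ?_
    rw [mul_comm]
    exact mul_le_mul_of_nonneg_left (Real.exp_le_exp.2 (by linarith [ht.2])) (pow_nonneg ht.1 _)
  have hquot : ∀ x : ℝ, 0 < x →
      (lowerGamma ((n + 1 : ℕ) : ℝ) x / (n ! : ℝ)) / (x ^ (n + 1) / ((n + 1)! : ℝ)) =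
        lowerGamma ((n + 1 : ℕ) : ℝ) x / (x ^ (n + 1) / (n + 1)) := by
    intro x hx
    rw [Nat.factorial_succ]
    push_cast
    field_simp
  rw [isEquivalent_iff_tendsto_one]
  · have hexp : Tendsto (fun x : ℝ => Real.exp (-x)) (nhdsWithin 0 (Set.Ioi 0)) (nhds 1) := by
      have : Continuous fun x : ℝ => Real.exp (-x) := by fun_prop
      simpa using (this.tendsto 0).mono_left nhdsWithin_le_nhds
    refine tendsto_of_tendsto_of_tendsto_of_le_of_le' hexp tendsto_const_nhds ?_ ?_
    · filter_upwards [self_mem_nhdsWithin] with x hx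
      have hx : 0 < x := hx
      rw [Pi.div_apply, hquot x hx, le_div_iff₀ (by positivity)]
      exact hlower x hx
    · filter_upwards [self_mem_nhdsWithin] with x hx
      have hx : 0 < x := hx
      rw [Pi.div_apply, hquot x hx, div_le_one (by positivity)]
      exact hupper x hx
  · filter_upwards [self_mem_nhdsWithin] with x hx
    have hx : 0 < x := hx
    positivity

/-- For small `F` the term `p = 0` dominates the alternating sum. -/
lemma alternating_sum_isEquivalent {α : Type*} {f : Filter α} {F : α → ℝ}
    (hF : Tendsto F f (nhds 0)) (k l : ℕ) :
    (fun a => ∑ p ∈ Finset.range (k + 1), (k.choose p : ℝ) *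
        ((-1) ^ p * ((k + l + 1)! : ℝ) * F a ^ (l + p + 1) /
          ((l ! : ℝ) * (k ! : ℝ) * ((l + p + 1 : ℕ) : ℝ)))) ~[f]
      fun a => ((k + l + 1)! : ℝ) * F a ^ (l + 1) /
        ((l ! : ℝ) * (k ! : ℝ) * ((l + 1 : ℕ) : ℝ)) := by
  let Q : ℝ → ℝ := fun y => ∑ p ∈ Finset.range (k + 1), (k.choose p : ℝ) *
    ((-1) ^ p * ((k + l + 1)! : ℝ) * y ^ p / ((l ! : ℝ) * (k ! : ℝ) * ((l + p + 1 : ℕ) : ℝ)))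
  have hQ0 : Q 0 = ((k + l + 1)! : ℝ) / ((l ! : ℝ) * (k ! : ℝ) * ((l + 1 : ℕ) : ℝ)) := by
    simp only [Q]
    rw [Finset.sum_eq_single_of_mem 0 (by simp) fun p _ hp => by rw [zero_pow hp]; ring]
    simp
  have hQne : Q 0 ≠ 0 := by rw [hQ0]; positivity
  have hQ : Tendsto (fun a => Q (F a)) f (nhds (Q 0)) := by
    have : Continuous Q := by fun_prop
    exact (this.tendsto 0).comp hF
  have hQe : (fun a => Q (F a)) ~[f] fun _ => Q 0 := (isEquivalent_const_iff_tendsto hQne).2 hQ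
  have hfac : (fun a => ∑ p ∈ Finset.range (k + 1), (k.choose p : ℝ) *
        ((-1) ^ p * ((k + l + 1)! : ℝ) * F a ^ (l + p + 1) /
          ((l ! : ℝ) * (k ! : ℝ) * ((l + p + 1 : ℕ) : ℝ)))) =
      fun a => F a ^ (l + 1) * Q (F a) := by
    funext a
    rw [Finset.mul_sum]
    refine Finset.sum_congr rfl fun p _ => ?_
    rw [show l + p + 1 = l + 1 + p by ring, pow_add (F a)]
    ring
  have hlead : (fun a => ((k + l + 1)! : ℝ) * F a ^ (l + 1) /
        ((l ! : ℝ) * (k ! : ℝ) * ((l + 1 : ℕ) : ℝ))) = fun a => F a ^ (l + 1) * Q 0 := by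
    funext a
    rw [hQ0]
    ring
  rw [hfac, hlead]
  exact IsEquivalent.refl.mul hQe

/-! ### The outage probability -/

section Outage

variable {Ω : Type*} [MeasurableSpace Ω] {μ : Measure Ω} [IsProbabilityMeasure μ] {N M K : ℕ}
  {H : Fin M → Fin K → Ω → Matrix (Fin N) (Fin M) ℂ}

omit [IsProbabilityMeasure μ] in
lemma IsRayleigh.aemeasurable (hH : IsRayleigh μ H) (i : Fin M) (j : Fin K) (a : Fin N)
    (b : Fin M) : AEMeasurable (fun ω => H i j ω a b) μ :=
  (hH.law i j a b).aemeasurable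

/-- The columns of a single channel matrix are independent. -/
lemma IsRayleigh.iIndepFun_col (hH : IsRayleigh μ H) (i : Fin M) (j : Fin K) :
    iIndepFun (fun (b : Fin M) ω (a : Fin N) => H i j ω a b) μ := by
  refine iIndepFun_rows (fun b a => hH.aemeasurable i j a b) ?_
  refine (hH.indep i).precomp (g := fun q : Fin M × Fin N => (j, q.2, q.1)) fun p q hpq => ?_
  simp only [Prod.mk.injEq] at hpq
  exact Prod.ext hpq.2.2 hpq.2.1

omit [IsProbabilityMeasure μ] in
lemma IsRayleigh.hasLaw_col (hH : IsRayleigh μ H) (i : Fin M) (j : Fin K) (b : Fin M) :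
    HasLaw (fun ω (a : Fin N) => H i j ω a b) (gaussianVec N) μ := by
  refine iIndepFun.hasLaw_pi (fun a => hH.law i j a b) ?_
  refine (hH.indep i).precomp (g := fun a : Fin N => (j, a, b)) fun p q hpq => ?_
  simp only [Prod.mk.injEq] at hpq
  exact hpq.2.1

/-- The effective channel gain of the unordered user `j` of cluster `i`, as a function of its
channel matrix alone: it does not depend on the choice of a basis of the left null space. -/
noncomputable def residualGain (i : Fin M) (H : Matrix (Fin N) (Fin M) ℂ) : ℝ :=
  residual (Matrix.of fun a (m : (Finset.univ.erase i : Finset (Fin M))) => H a m)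
    (fun a => H a i)

lemma IsRayleigh.measureReal_residualGain_lt (hH : IsRayleigh μ H) (hMN : M ≤ N) (i : Fin M)
    (j : Fin K) {x : ℝ} (hx : 0 ≤ x) :
    μ.real {ω | residualGain i (H i j ω) < x} =
      lowerGamma ((N - M + 1 : ℕ) : ℝ) x / ((N - M)! : ℝ) := by
  have hM : 0 < M := i.pos
  exact residual_measureReal_lt (hH.iIndepFun_col i j) (hH.hasLaw_col i j)
    (Finset.notMem_erase i Finset.univ) (by simp; omega) hx

lemma measurable_residualGain (i : Fin M) : Measurable fun c : Fin M → Fin N → ℂ =>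
    residualGain i (Matrix.of fun a b => c b a) := by
  have hc : Measurable fun c : Fin M → Fin N → ℂ =>
      ((fun m : (Finset.univ.erase i : Finset (Fin M)) => c m), c i) := by fun_prop
  have h := measurable_residual.comp hc
  simp only [Function.comp_def] at h
  simpa only [residualGain, Matrix.of_apply] using h

omit [IsProbabilityMeasure μ] in
lemma IsRayleigh.aemeasurable_residualGain (hH : IsRayleigh μ H) (i : Fin M) (j : Fin K) :
    AEMeasurable (fun ω => residualGain i (H i j ω)) μ :=
  (measurable_residualGain i).comp_aemeasurable
    (f := fun ω b a => H i j ω a b)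
    (aemeasurable_pi_lambda _ fun b => (hH.hasLaw_col i j b).aemeasurable)

/-- The effective gains of the users of one cluster are independent. -/
lemma IsRayleigh.iIndepFun_residualGain (hH : IsRayleigh μ H) (i : Fin M) :
    iIndepFun (fun j ω => residualGain i (H i j ω)) μ := by
  have h : iIndepFun (fun (j : Fin K) ω (q : Fin N × Fin M) => H i j ω q.1 q.2) μ :=
    iIndepFun_rows (fun j q => hH.aemeasurable i j q.1 q.2) (hH.indep i)
  have hswap : Measurable fun (y : Fin N × Fin M → ℂ) (b : Fin M) (a : Fin N) => y (a, b) := by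
    fun_prop
  exact h.comp _ fun _ => (measurable_residualGain i).comp hswap

/-- Almost surely, the energy collected through any orthonormal null basis is the intrinsic
residual gain. -/
lemma IsRayleigh.ae_eq_residualGain (hH : IsRayleigh μ H) (hMN : M ≤ N) (i : Fin M) :
    ∀ᵐ ω ∂μ, ∀ (j : Fin K) (U : Matrix (Fin N) (Fin (N - M + 1)) ℂ), IsNullBasis i (H i j ω) U →
      enorm₂ (Uᴴ *ᵥ fun a => H i j ω a i) ^ 2 = residualGain i (H i j ω) := by
  have hM : 0 < M := i.pos
  have hcard : (Finset.univ.erase i : Finset (Fin M)).card = M - 1 := by simp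
  rw [ae_all_iff]
  intro j
  filter_upwards [ae_linearIndepOn (hH.iIndepFun_col i j) (hH.hasLaw_col i j)
    (Finset.univ.erase i) (by omega)] with ω hω U hU
  refine (residual_eq (by simp; omega)
    (isUnit_det_conjTranspose_mul_self hω) hU.orthonormal ?_ _).symm
  ext m b
  exact congrFun (congrFun hU.null ⟨m, Finset.ne_of_mem_erase m.2⟩) b

/-- The exact outage probability, with the position `k` in the ordering counted from zero: outage
occurs iff at most `k` users have an effective gain that reaches the threshold. -/
lemma outageProb_eq (hH : IsRayleigh μ H) (hMN : M ≤ N)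
    {U : Fin M → Fin K → Ω → Matrix (Fin N) (Fin (N - M + 1)) ℂ}
    (hU : ∀ᵐ ω ∂μ, ∀ i j, IsNullBasis i (H i j ω) (U i j ω))
    {τ : Fin M → Ω → Equiv.Perm (Fin K)}
    (hτ : ∀ᵐ ω ∂μ, ∀ i, IsOrdering
      (fun j => gain (detection i (H i j ω) (U i j ω)) (H i j ω)
        (fun a => (1 : Matrix (Fin M) (Fin M) ℂ) a i)) (τ i ω))
    (i : Fin M) {k l : ℕ} (hK : K = k + l + 1) {R ρ : ℝ} (hR : 0 ≤ R) (hρ : 0 < ρ) :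
    outageProb μ H U 1 τ i ⟨k, by omega⟩ R ρ =
      ∑ p ∈ Finset.range (k + 1), (k.choose p : ℝ) *
        ((-1) ^ p * ((k + l + 1)! : ℝ) *
          (lowerGamma ((N - M + 1 : ℕ) : ℝ) (threshold K R ρ) / ((N - M)! : ℝ)) ^ (l + p + 1) /
          ((l ! : ℝ) * (k ! : ℝ) * ((l + p + 1 : ℕ) : ℝ))) := by
  have hx : 0 ≤ threshold K R ρ :=
    div_nonneg (sub_nonneg.2 (Real.one_le_rpow one_le_two (by positivity))) hρ.le
  rw [← sum_choose_eq_sum_alternating, ← hK, ← measureReal_card_le (hH.iIndepFun_residualGain i)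
    (hH.aemeasurable_residualGain i) (fun j => hH.measureReal_residualGain_lt hMN i j hx)]
  refine measureReal_congr ?_
  filter_upwards [hU, hτ, hH.ae_eq_residualGain hMN i] with ω h1 h2 h3
  have hgain : (fun j => gain (detection i (H i j ω) (U i j ω)) (H i j ω)
      (fun a => (1 : Matrix (Fin M) (Fin M) ℂ) a i)) = fun j => residualGain i (H i j ω) :=
    funext fun j => (gain_detection_self _ _).trans (h3 j _ (h1 i j))
  have h2 := h2 i
  rw [hgain] at h2
  refine propext ?_
  change omaRate K (sinr 1 ρ i _ _) < R ↔
    (Finset.univ.filter fun j => threshold K R ρ ≤ residualGain i (H i j ω)).card ≤ k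
  rw [sinr_detection (h1 i _),
    omaRate_lt_iff (by omega) hρ (sq_nonneg _), h3 _ _ (h1 i _)]
  exact h2.lt_iff ⟨k, by omega⟩ _

/-- As `ρ → ∞` the threshold decreases to zero, unless the target rate vanishes. -/
lemma tendsto_threshold (hK : 0 < K) {R : ℝ} (hR : 0 < R) :
    Tendsto (threshold K R) atTop (nhdsWithin 0 (Set.Ioi 0)) := by
  have hc : 0 < (2 : ℝ) ^ ((K : ℝ) * R) - 1 :=
    sub_pos.2 (Real.one_lt_rpow one_lt_two (by positivity))
  refine tendsto_nhdsWithin_iff.2 ⟨tendsto_const_nhds.div_atTop tendsto_id, ?_⟩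
  filter_upwards [eventually_gt_atTop 0] with ρ hρ
  exact div_pos hc hρ

end Outage

end MimoOma

theorem corollary1 {Ω : Type*} [MeasurableSpace Ω] (μ : Measure Ω) [IsProbabilityMeasure μ]
    (N M K : ℕ) (hMN : M ≤ N)
    (H : Fin M → Fin K → Ω → Matrix (Fin N) (Fin M) ℂ) (hH : MimoOma.IsRayleigh μ H)
    (U : Fin M → Fin K → Ω → Matrix (Fin N) (Fin (N - M + 1)) ℂ)
    (hU : ∀ᵐ ω ∂μ, ∀ i j, MimoOma.IsNullBasis i (H i j ω) (U i j ω))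
    (P : Matrix (Fin M) (Fin M) ℂ) (hP : P = 1)
    (τ : Fin M → Ω → Equiv.Perm (Fin K))
    (hτ : ∀ᵐ ω ∂μ, ∀ i, MimoOma.IsOrdering
      (fun j => MimoOma.gain (MimoOma.detection i (H i j ω) (U i j ω)) (H i j ω)
        (fun a => P a i)) (τ i ω))
    (R : Fin M → Fin K → ℝ) (hR : ∀ i k, 0 ≤ R i k)
    (i : Fin M) (k : ℕ) (hk : 1 ≤ k) (hkK : k ≤ K) :
    (∀ ρ : ℝ, 0 < ρ →
      MimoOma.outageProb μ H U P τ i ⟨k - 1, by omega⟩ (R i ⟨k - 1, by omega⟩) ρ =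
        ∑ p ∈ Finset.range k, ((k - 1).choose p : ℝ) *
          ((-1) ^ p * (K ! : ℝ) *
            (MimoOma.lowerGamma ((N - M + 1 : ℕ) : ℝ)
                (MimoOma.threshold K (R i ⟨k - 1, by omega⟩) ρ) / ((N - M)! : ℝ))
              ^ (K - k + p + 1) /
            (((K - k)! : ℝ) * ((k - 1)! : ℝ) * ((K - k + p + 1 : ℕ) : ℝ)))) ∧
    (fun ρ : ℝ =>
        MimoOma.outageProb μ H U P τ i ⟨k - 1, by omega⟩ (R i ⟨k - 1, by omega⟩) ρ)
      ~[atTop]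
      (fun ρ : ℝ =>
        (K ! : ℝ) *
          (MimoOma.threshold K (R i ⟨k - 1, by omega⟩) ρ ^ (N - M + 1) /
            ((N - M + 1)! : ℝ)) ^ (K - k + 1) /
          (((K - k)! : ℝ) * ((k - 1)! : ℝ) * ((K - k + 1 : ℕ) : ℝ))) := by
  subst hP
  obtain ⟨k, rfl⟩ : ∃ k', k = k' + 1 := ⟨k - 1, by omega⟩
  obtain ⟨l, rfl⟩ : ∃ l, K = k + l + 1 := ⟨K - (k + 1), by omega⟩
  have hl : k + l + 1 - (k + 1) = l := by omega
  simp only [Nat.add_sub_cancel, hl]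
  have hR' := hR i ⟨k, by omega⟩
  set R' := R i ⟨k, by omega⟩
  have hexact (ρ : ℝ) (hρ : 0 < ρ) :=
    MimoOma.outageProb_eq hH hMN hU hτ i (k := k) (l := l) rfl hR' hρ
  refine ⟨hexact, ?_⟩
  have hev := (eventually_gt_atTop (0 : ℝ)).mono hexact
  refine IsEquivalent.congr_left ?_ (EventuallyEq.symm hev)
  rcases hR'.eq_or_lt with h0 | h0
  · -- for the target rate zero both sides vanish identically
    have hthr (ρ : ℝ) : MimoOma.threshold (k + l + 1) R' ρ = 0 := by
      simp [MimoOma.threshold, ← h0]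
    simp [hthr, MimoOma.lowerGamma, IsEquivalent.refl]
  · have hF := (MimoOma.lowerGamma_isEquivalent (N - M)).comp_tendsto
      (MimoOma.tendsto_threshold (K := k + l + 1) (by omega) h0)
    have hpow : Tendsto (fun x : ℝ => x ^ (N - M + 1) / ((N - M + 1)! : ℝ))
        (nhdsWithin 0 (Set.Ioi 0)) (nhds 0) := by
      have hcont : Continuous fun x : ℝ => x ^ (N - M + 1) / ((N - M + 1)! : ℝ) := by fun_prop
      simpa using (hcont.tendsto 0).mono_left nhdsWithin_le_nhds
    have hF0 := hF.symm.tendsto_nhds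
      (hpow.comp (MimoOma.tendsto_threshold (K := k + l + 1) (by omega) h0))
    refine (MimoOma.alternating_sum_isEquivalent hF0 k l).trans ?_
    exact (IsEquivalent.refl.mul (hF.pow (l + 1))).div IsEquivalent.refl
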